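/- An $\mathsf{Fset}$-category is a small category $C$ whose hom-sets carry exhaustive increasing filtrations $C(a,b)_\ell\subset C(a,b)$, $\ell\in\mathbb{R}_{\ge 0}$, such that $\mathrm{id}_a\in C(a,a)_0$ and composition maps $C(a,b)_\ell\times C(b,c)_{\ell'}$ into $C(a,c)_{\ell+\ell'}$. A morphism $f$ has degree $\ell$ if $\ell$ is the smallest level containing $f$. A functor of $\mathsf{Fset}$-categories is a functor that preserves the levels. The product $C\times D$ has the levels $(C\times D)_\ell=\bigcup_{\ell'+\ell''=\ell}C_{\ell'}\times D_{\ell''}$ on hom-sets. For $r\ge 0$ let $I_r$ be the $\mathsf{Fset}$-category with two objects $0,1$ and one non-identity morphism $0\to 1$, of degree $r$. An $r$-natural transformation $F\Rightarrow G$ between functors $F,G:C\to D$ is a functor of $\mathsf{Fset}$-categories $\tau:C\times I_r\to D$ with $\tau(-,0)=F$ and $\tau(-,1)=G$. Let $\mathsf{FC}_\bullet C$ be the chain complex with $\mathsf{FC}_nC$ the free abelian group on the chains $a_0\xrightarrow{f_1}\cdots\xrightarrow{f_n}a_n$ of $C$ (the $n$-simplices of the nerve), with differential the alternating sum of the faces,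 filtered by letting $F_p\mathsf{FC}_nC$ be generated by the chains with $\sum_i\deg f_i\le p$. If all morphisms of $C$ have degrees in $\mathbb{Z}_{\ge0}$, let $E^r_{p,q}C$ be the spectral sequence of this $\mathbb{Z}_{\ge0}$-filtered complex. **Theorem.** (1) Let $C,D$ be $\mathsf{Fset}$-categories all of whose morphisms have degrees in $\mathbb{Z}_{\ge 0}$, let $r\in\mathbb{Z}_{\ge0}$, and let $F,G:C\to D$ be functors of $\mathsf{Fset}$-categories. If there is an $r$-natural transformation $F\Rightarrow G$, then $F$ and $G$ induce identical homomorphisms $E^{r+1}_{p,q}C\to E^{r+1}_{p,q}D$ for all $p,q$. This covers the following cases. (2) Regard ordinary small categories as $\mathsf{Fset}$-categories with all morphisms of degree $0$. For functors $F,G$ between small categories, a $0$-natural transformation $F\Rightarrow G$ exists if and only if a natural transformation $F\Rightarrow G$ exists; and an equivalence of small categories induces isomorphisms on $E^1$. (3) Regard a generalized metric space $X$ (with $d(x,x)=0$ and the triangle inequality, $d$ possibly infinite, asymmetric or degenerate) as an $\mathsf{Fset}$-category with one morphism $x\to y$, of degree $d(x,y)$, if $d(x,y)<\infty$, and none otherwise;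 regard a digraph as the generalized metric space given by its directed path metric, and digraph homomorphisms as $1$-Lipschitz maps. For digraph homomorphisms $f,g:G\to H$, a $1$-natural transformation $f\Rightarrow g$ exists if and only if there is a one-step digraph homotopy from $f$ to $g$, that is, a digraph homomorphism $G\,\square\,(0\to1)\to H$ restricting to $f$ at $0$ and to $g$ at $1$, where $\square$ is the Cartesian product of digraphs. If there is a one-step homotopy from $f$ to $g$ or from $g$ to $f$, then $f$ and $g$ induce identical homomorphisms on $E^2$. (4) For $1$-Lipschitz maps $f,g:X\to Y$ of generalized metric spaces and real $r\ge0$, an $r$-natural transformation $f\Rightarrow g$ exists if and only if $f$ and $g$ are $r$-close, that is, $d(f(x),g(x))\le r$ for all $x\in X$. If all distances of $X$ and $Y$ lie in $\mathbb{Z}_{\ge0}\cup\{\infty\}$, $r\in\mathbb{Z}_{\ge0}$ and $f,g$ are $r$-close, then $f$ and $g$ induce identical homomorphisms on $E^{r+1}$. -/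

import Mathlib

open CategoryTheory
open scoped NNReal ENNReal

universe u v u' v' w

noncomputable section

/-! ### Categories enriched over filtered sets -/

/-- A (small) category enriched over `ℝ≥0`-filtered sets: a category in which every hom-set is an
exhausted increasing union of subsets `filt a b ℓ`, `ℓ ≥ 0`. The unit `∗(0) → C(a, a)` and the
composition `C(a, b) × C(b, c) → C(a, c)` being filtered maps is expressed by `id_mem` and
`comp_mem`. -/
structure FsetCat where
  Ob : Type u
  [cat : Category.{v} Ob]
  filt : ∀ a b : Ob, ℝ≥0 → Set (a ⟶ b)
  filt_mono : ∀ a b : Ob, Monotone (filt a b)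
  filt_exhaust : ∀ (a b : Ob) (f : a ⟶ b), ∃ ℓ, f ∈ filt a b ℓ
  id_mem : ∀ a : Ob, 𝟙 a ∈ filt a a 0
  comp_mem : ∀ {a b c : Ob} (f : a ⟶ b) (g : b ⟶ c) {ℓ ℓ' : ℝ≥0},
    f ∈ filt a b ℓ → g ∈ filt b c ℓ' → f ≫ g ∈ filt a c (ℓ + ℓ')

attribute [instance] FsetCat.cat

namespace FsetCat

/-- `deg f = ℓ`, that is, `f` lies in level `ℓ` and in no smaller level. -/
def HasDeg (C : FsetCat.{u, v}) {a b : C.Ob} (f : a ⟶ b) (ℓ : ℝ≥0) : Prop :=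
  f ∈ C.filt a b ℓ ∧ ∀ ℓ' < ℓ, f ∉ C.filt a b ℓ'

/-- The category is enriched over `ℤ≥0`-filtered sets: every morphism has a degree, which is a
non-negative integer. -/
def IsIntegral (C : FsetCat.{u, v}) : Prop :=
  ∀ (a b : C.Ob) (f : a ⟶ b), ∃ n : ℕ, C.HasDeg f n

/-- The tensor product `C × D`. -/
def prod (C : FsetCat.{u, v}) (D : FsetCat.{u', v'}) : FsetCat.{max u u', max v v'} where
  Ob := C.Ob × D.Ob
  cat := CategoryTheory.prod' C.Ob D.Ob
  filt a b ℓ := {f | ∃ ℓ' ℓ'' : ℝ≥0, ℓ' + ℓ'' = ℓ ∧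
    f.1 ∈ C.filt a.1 b.1 ℓ' ∧ f.2 ∈ D.filt a.2 b.2 ℓ''}
  filt_mono a b ℓ₁ ℓ₂ h := by
    rintro f ⟨x, y, rfl, hx, hy⟩
    have hxl : x ≤ ℓ₂ := le_trans le_self_add h
    refine ⟨x, ℓ₂ - x, add_tsub_cancel_of_le hxl, hx, D.filt_mono _ _ ?_ hy⟩
    exact le_tsub_of_add_le_left h
  filt_exhaust a b f := by
    obtain ⟨x, hx⟩ := C.filt_exhaust _ _ f.1
    obtain ⟨y, hy⟩ := D.filt_exhaust _ _ f.2
    exact ⟨x + y, x, y, rfl, hx, hy⟩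
  id_mem a := ⟨0, 0, add_zero 0, C.id_mem _, D.id_mem _⟩
  comp_mem := by
    rintro a b c f g _ _ ⟨x, y, rfl, hx, hy⟩ ⟨x', y', rfl, hx', hy'⟩
    exact ⟨x + x', y + y', by ring, C.comp_mem _ _ hx hx', D.comp_mem _ _ hy hy'⟩

/-- `I_r`: two objects `0`, `1` and one non-identity morphism `0 ⟶ 1`, of degree `r`. -/
def interval (r : ℝ≥0) : FsetCat.{0, 0} where
  Ob := Fin 2
  cat := inferInstanceAs (Category (Fin 2))
  filt a b ℓ := {_f | a ≠ b → r ≤ ℓ}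
  filt_mono _ _ _ _ h _ hf hab := (hf hab).trans h
  filt_exhaust _ _ _ := ⟨r, fun _ => le_rfl⟩
  id_mem _ h := absurd rfl h
  comp_mem := by
    intro a b c f g ℓ ℓ' hf hg hac
    by_cases hab : a = b
    · exact (hg (hab ▸ hac)).trans le_add_self
    · exact (hf hab).trans le_self_add

end FsetCat

/-- A functor of categories enriched over filtered sets. -/
structure FsetFunctor (C : FsetCat.{u, v}) (D : FsetCat.{u', v'}) where
  toFunctor : C.Ob ⥤ D.Ob
  map_mem : ∀ {a b : C.Ob} (f : a ⟶ b) {ℓ : ℝ≥0}, f ∈ C.filt a b ℓ →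
    toFunctor.map f ∈ D.filt (toFunctor.obj a) (toFunctor.obj b) ℓ

/-- The inclusion `(-, i) : C ⥤ C × I_r` at an object `i` of `I_r`. -/
def FsetCat.incl (C : FsetCat.{u, v}) (r : ℝ≥0) (i : Fin 2) :
    C.Ob ⥤ (C.prod (FsetCat.interval r)).Ob :=
  Prod.sectL C.Ob (show (FsetCat.interval r).Ob from i)

/-- An `r`-natural transformation `F ⇒ G`: a functor `τ : C × I_r ⟶ D` of categories enriched over
filtered sets with `τ(-, 0) = F` and `τ(-, 1) = G`. -/
structure RNatTrans (r : ℝ≥0) {C : FsetCat.{u, v}} {D : FsetCat.{u', v'}}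
    (F G : FsetFunctor C D) where
  τ : FsetFunctor (C.prod (FsetCat.interval r)) D
  at_zero : C.incl r 0 ⋙ τ.toFunctor = F.toFunctor
  at_one : C.incl r 1 ⋙ τ.toFunctor = G.toFunctor

/-! ### Filtered chain complexes and their spectral sequence -/

/-- A non-negative chain complex of abelian groups with an exhaustive increasing filtration by
subcomplexes indexed by the integers, which vanishes in negative filtration degrees. -/
structure FilteredComplex where
  K : ChainComplex AddCommGrpCat.{w} ℕ
  F : ℤ → ∀ n : ℕ, AddSubgroup (K.X n)
  mono : ∀ n : ℕ, Monotone fun p => F p n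
  neg : ∀ (p : ℤ) (n : ℕ), p < 0 → F p n = ⊥
  exhaust : ∀ (n : ℕ) (x : K.X n), ∃ p, x ∈ F p n
  d_mem : ∀ (p : ℤ) (n m : ℕ) (x : K.X n), x ∈ F p n → K.d n m x ∈ F p m

namespace FilteredComplex

/-- A filtered chain map. -/
structure Hom (A B : FilteredComplex.{w}) where
  f : A.K ⟶ B.K
  f_mem : ∀ (p : ℤ) (n : ℕ) (x : A.K.X n), x ∈ A.F p n → f.f n x ∈ B.F p n

variable (A B : FilteredComplex.{w})

/-- `Z^r_p = {x ∈ F_p A_n | ∂x ∈ F_{p-r} A_{n-1}}`. -/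
def Z (r : ℕ) (p : ℤ) (n : ℕ) : AddSubgroup (A.K.X n) where
  carrier := {x | x ∈ A.F p n ∧ ∀ m, A.K.d n m x ∈ A.F (p - r) m}
  zero_mem' := ⟨zero_mem _, fun m => by rw [map_zero]; exact zero_mem _⟩
  add_mem' hx hy := ⟨add_mem hx.1 hy.1, fun m => by rw [map_add]; exact add_mem (hx.2 m) (hy.2 m)⟩
  neg_mem' hx := ⟨neg_mem hx.1, fun m => by rw [map_neg]; exact neg_mem (hx.2 m)⟩

/-- `Z^r_p ∩ F_{p-1} A_n + (∂ F_{p+r-1} A_{n+1}) ∩ F_p A_n`. For `r ≥ 1` this is the usual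
`Z^{r-1}_{p-1} + ∂ Z^{r-1}_{p+r-1}`; for `r = 0` it is `F_{p-1} A_n`. -/
def B' (r : ℕ) (p : ℤ) (n : ℕ) : AddSubgroup (A.K.X n) :=
  (A.Z r p n ⊓ A.F (p - 1) n) ⊔
    ((A.F (p + r - 1) (n + 1)).map (A.K.d (n + 1) n).hom ⊓ A.F p n)

/-- The term `E^r_{p, q}`, `q = n - p`, of the spectral sequence of a filtered complex, where `p` is
the filtration degree and `n = p + q` the total degree (the terms with `p + q < 0` are zero). -/
def E (r : ℕ) (p : ℤ) (n : ℕ) : Type w :=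
  A.Z r p n ⧸ (A.B' r p n).addSubgroupOf (A.Z r p n)

instance (r : ℕ) (p : ℤ) (n : ℕ) : AddCommGroup (A.E r p n) :=
  inferInstanceAs (AddCommGroup (A.Z r p n ⧸ (A.B' r p n).addSubgroupOf (A.Z r p n)))

variable {A B}

theorem Hom.map_Z (φ : Hom A B) (r : ℕ) (p : ℤ) (n : ℕ) (x : A.K.X n) (hx : x ∈ A.Z r p n) :
    φ.f.f n x ∈ B.Z r p n := by
  refine ⟨φ.f_mem p n x hx.1, fun m => ?_⟩
  have h : B.K.d n m (φ.f.f n x) = φ.f.f m (A.K.d n m x) := by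
    rw [← ConcreteCategory.comp_apply, ← ConcreteCategory.comp_apply, φ.f.comm]
  rw [h]
  exact φ.f_mem _ _ _ (hx.2 m)

/-- The homomorphism `Z^r_p A → Z^r_p B` induced by a filtered chain map. -/
def Hom.ZMap (φ : Hom A B) (r : ℕ) (p : ℤ) (n : ℕ) : A.Z r p n →+ B.Z r p n :=
  ((φ.f.f n).hom.comp (A.Z r p n).subtype).codRestrict _ fun x => φ.map_Z r p n x x.2

theorem Hom.map_B' (φ : Hom A B) (r : ℕ) (p : ℤ) (n : ℕ) :
    (A.B' r p n).addSubgroupOf (A.Z r p n) ≤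
      ((B.B' r p n).addSubgroupOf (B.Z r p n)).comap (φ.ZMap r p n) := by
  rintro ⟨x, hxZ⟩ hx
  change x ∈ A.B' r p n at hx
  change φ.f.f n x ∈ B.B' r p n
  obtain ⟨y, hy, z, hz, rfl⟩ := AddSubgroup.mem_sup.1 hx
  rw [map_add]
  refine AddSubgroup.add_mem_sup ⟨φ.map_Z r p n y hy.1, φ.f_mem _ _ _ hy.2⟩ ⟨?_, φ.f_mem _ _ _ hz.2⟩
  obtain ⟨t, ht, rfl⟩ := hz.1
  refine ⟨φ.f.f (n + 1) t, φ.f_mem _ _ _ ht, ?_⟩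
  change B.K.d (n + 1) n (φ.f.f (n + 1) t) = φ.f.f n (A.K.d (n + 1) n t)
  rw [← ConcreteCategory.comp_apply, ← ConcreteCategory.comp_apply, φ.f.comm]

/-- The homomorphism of `r`-th pages induced by a filtered chain map. -/
def Hom.EMap (φ : Hom A B) (r : ℕ) (p : ℤ) (n : ℕ) : A.E r p n →+ B.E r p n :=
  QuotientAddGroup.map _ _ (φ.ZMap r p n) (φ.map_B' r p n)

end FilteredComplex

/-! ### The filtered nerve and the filtered chain complex `FC` -/

namespace FsetCat

/-- Level `ℓ` of the filtered nerve: the chains `a₀ ⟶ a₁ ⟶ ⋯ ⟶ aₙ` that lie in level `ℓ` of the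
product `C(a₀, a₁) × ⋯ × C(aₙ₋₁, aₙ)` of filtered sets (for `n = 0`: all objects if `ℓ ≥ 0`). If the
arrows have degrees, this says that the sum of the degrees is at most `ℓ`. It is empty for
`ℓ < 0`. -/
def nerveLevel (C : FsetCat.{u, v}) (n : ℕ) (ℓ : ℝ) : Set (ComposableArrows C.Ob n) :=
  {x | ∃ c : Fin n → ℝ≥0, ((∑ i, c i : ℝ≥0) : ℝ) ≤ ℓ ∧
    ∀ i : Fin n, x.map (homOfLE i.castSucc_le_succ) ∈ C.filt (x.obj i.castSucc) (x.obj i.succ) (c i)}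

/-- The chain complex of the free simplicial abelian group on the nerve, with differential the
alternating sum of the faces. -/
def chains (C : FsetCat.{u, v}) : ChainComplex AddCommGrpCat.{max u v} ℕ :=
  (AlgebraicTopology.alternatingFaceMapComplex _).obj
    (((SimplicialObject.whiskering _ _).obj AddCommGrpCat.free).obj (nerve C.Ob))

/-- The subgroup of the free abelian group on the `n`-chains that is generated by level `p`. -/
def chainsFilt (C : FsetCat.{u, v}) (p : ℤ) (n : ℕ) : AddSubgroup (C.chains.X n) :=
  AddSubgroup.closure
    ((FreeAbelianGroup.of : ComposableArrows C.Ob n → FreeAbelianGroup _) '' C.nerveLevel n p)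

theorem nerveLevel_mono (C : FsetCat.{u, v}) (n : ℕ) : Monotone (C.nerveLevel n) := by
  rintro ℓ ℓ' h x ⟨c, hc, hx⟩
  exact ⟨c, hc.trans h, hx⟩

theorem map_mem_filt (C : FsetCat.{u, v}) {n : ℕ} (x : ComposableArrows C.Ob n) (s : Fin (n + 1) → ℝ≥0)
    (hs : ∀ i : Fin n, s i.castSucc ≤ s i.succ)
    (hx : ∀ i : Fin n, x.map (homOfLE i.castSucc_le_succ) ∈
      C.filt (x.obj i.castSucc) (x.obj i.succ) (s i.succ - s i.castSucc))
    (a b : Fin (n + 1)) (hab : a ≤ b) :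
    x.map (homOfLE hab) ∈ C.filt (x.obj a) (x.obj b) (s b - s a) := by
  have hmono : Monotone s := Fin.monotone_iff_le_succ.2 hs
  revert hab
  induction b using Fin.induction with
  | zero =>
    intro hab
    obtain rfl : a = 0 := le_antisymm hab (Fin.zero_le a)
    have h : x.map (homOfLE hab) = 𝟙 _ := x.map_id _
    rw [h, tsub_self]
    exact C.id_mem _
  | succ b ih =>
    intro hab
    rcases hab.eq_or_lt with rfl | hlt
    · have h : x.map (homOfLE hab) = 𝟙 _ := x.map_id _
      rw [h, tsub_self]
      exact C.id_mem _
    · have hab' : a ≤ b.castSucc := Fin.le_castSucc_iff.2 hlt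
      have h : x.map (homOfLE hab) = x.map (homOfLE hab') ≫ x.map (homOfLE b.castSucc_le_succ) := by
        rw [← x.map_comp]; rfl
      rw [h]
      have h2 := C.comp_mem _ _ (ih hab') (hx b)
      have h3 : s b.succ - s a = s b.castSucc - s a + (s b.succ - s b.castSucc) := by
        rw [add_comm, tsub_add_tsub_cancel (hs b) (hmono hab')]
      rwa [h3]

/-- The simplicial operators of the nerve preserve the levels. -/
theorem nerve_map_mem (C : FsetCat.{u, v}) {m n : ℕ} (φ : SimplexCategory.mk m ⟶ SimplexCategory.mk n) (ℓ : ℝ)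
    (x : ComposableArrows C.Ob n) (hx : x ∈ C.nerveLevel n ℓ) :
    ((nerve C.Ob).map φ.op x : ComposableArrows C.Ob m) ∈ C.nerveLevel m ℓ := by
  obtain ⟨c, hc, hx⟩ := hx
  let s : Fin (n + 1) → ℝ≥0 := Fin.partialSum c
  have hss : ∀ i : Fin n, s i.succ = s i.castSucc + c i := fun i => Fin.partialSum_succ c i
  have hs : ∀ i : Fin n, s i.castSucc ≤ s i.succ := fun i => by rw [hss]; exact le_self_add
  have hmono : Monotone s := Fin.monotone_iff_le_succ.2 hs
  have key := C.map_mem_filt x s hs fun i => by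
    rw [hss, add_tsub_cancel_left]; exact hx i
  let g : Fin (m + 1) → Fin (n + 1) := fun j => φ.toOrderHom j
  have hg : Monotone g := φ.toOrderHom.monotone
  refine ⟨fun j => s (g j.succ) - s (g j.castSucc), le_trans ?_ hc, fun j => ?_⟩
  · have tel : ∀ (k : ℕ) (t : Fin (k + 1) → ℝ≥0), Monotone t →
        ∑ j : Fin k, (t j.succ - t j.castSucc) = t (Fin.last k) - t 0 := by
      intro k
      induction k with
      | zero => intro t _; simp
      | succ k ih =>
        intro t ht
        rw [Fin.sum_univ_castSucc]
        have := ih (fun j => t j.castSucc) (ht.comp Fin.strictMono_castSucc.monotone)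
        simp only [Fin.castSucc_zero] at this
        simp only [Fin.succ_castSucc, Fin.succ_last]
        rw [this, add_comm, tsub_add_tsub_cancel (ht (Fin.le_last _)) (ht (Fin.zero_le _))]
    have htot : ∑ i, c i = s (Fin.last n) := by
      have := tel n s hmono
      simp only [hss, add_tsub_cancel_left] at this
      rw [this]
      simp [s]
    rw [tel m (fun j => s (g j)) (hmono.comp hg), htot]
    exact_mod_cast tsub_le_self.trans (hmono (Fin.le_last _))
  · exact key _ _ (hg j.castSucc_le_succ)

theorem _root_.AddCommGrpCat.sum_zsmul_apply_mem {A B : AddCommGrpCat.{w}} {k : ℕ}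
    (φ : Fin k → (A ⟶ B)) (z : Fin k → ℤ) (x : A) (S : AddSubgroup B)
    (h : ∀ i, (φ i).hom x ∈ S) : (∑ i, z i • φ i).hom x ∈ S := by
  let ev : (A ⟶ B) →+ B :=
    { toFun := fun ψ => ψ.hom x
      map_zero' := rfl
      map_add' := fun _ _ => rfl }
  change ev (∑ i, z i • φ i) ∈ S
  rw [map_sum]
  refine sum_mem fun i _ => ?_
  rw [map_zsmul]
  exact zsmul_mem (h i) _

theorem chains_d_mem (C : FsetCat.{u, v}) (p : ℤ) (n m : ℕ) (x : C.chains.X n)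
    (hx : x ∈ C.chainsFilt p n) : C.chains.d n m x ∈ C.chainsFilt p m := by
  by_cases h : m + 1 = n
  · subst h
    refine (AddSubgroup.closure_le ((C.chainsFilt p m).comap (C.chains.d (m + 1) m).hom)).2 ?_ hx
    rintro _ ⟨y, hy, rfl⟩
    change (C.chains.d (m + 1) m).hom (FreeAbelianGroup.of y) ∈ C.chainsFilt p m
    have hd : C.chains.d (m + 1) m = _ :=
      AlgebraicTopology.alternatingFaceMapComplex_obj_d
        (((SimplicialObject.whiskering _ _).obj AddCommGrpCat.free).obj (nerve C.Ob)) m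
    rw [hd]
    refine AddCommGrpCat.sum_zsmul_apply_mem _ _ _ _ fun i => AddSubgroup.subset_closure
      ⟨(nerve C.Ob).δ i y, C.nerve_map_mem (SimplexCategory.δ i) p y hy, ?_⟩
    exact (FreeAbelianGroup.map_of_apply _).symm
  · rw [C.chains.shape n m h]
    exact zero_mem _

/-- The filtered chain complex `FC C`. Its filtration is indexed by the integers, which is the whole
filtration if all degrees are integers. -/
def FC (C : FsetCat.{u, v}) : FilteredComplex.{max u v} where
  K := C.chains
  F := C.chainsFilt
  mono n p q h := AddSubgroup.closure_mono (Set.image_mono (C.nerveLevel_mono n (by exact_mod_cast h)))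
  neg p n h := by
    refine AddSubgroup.closure_eq_bot_iff.2 ?_
    rintro _ ⟨x, ⟨c, hc, -⟩, rfl⟩
    have h1 : (p : ℝ) < 0 := by exact_mod_cast h
    exact absurd (NNReal.coe_nonneg _) (not_le.2 (hc.trans_lt h1))
  exhaust n x := by
    have hmono : Monotone fun p => C.chainsFilt p n := fun p q h =>
      AddSubgroup.closure_mono (Set.image_mono (C.nerveLevel_mono n (by exact_mod_cast h)))
    change FreeAbelianGroup (ComposableArrows C.Ob n) at x
    induction x using FreeAbelianGroup.induction_on with
    | zero => exact ⟨0, zero_mem _⟩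
    | of x =>
      choose c hc using fun i : Fin n =>
        C.filt_exhaust _ _ (x.map (homOfLE i.castSucc_le_succ))
      obtain ⟨N, hN⟩ := exists_nat_ge ((∑ i, c i : ℝ≥0) : ℝ)
      exact ⟨N, AddSubgroup.subset_closure ⟨x, ⟨c, by exact_mod_cast hN, hc⟩, rfl⟩⟩
    | neg x h => obtain ⟨p, hp⟩ := h; exact ⟨p, neg_mem hp⟩
    | add x y hx hy =>
      obtain ⟨p, hp⟩ := hx
      obtain ⟨q, hq⟩ := hy
      exact ⟨max p q, add_mem (hmono (le_max_left p q) hp) (hmono (le_max_right p q) hq)⟩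
  d_mem := C.chains_d_mem

end FsetCat

namespace FsetFunctor

variable {C D : FsetCat.{u, v}}

/-- The filtered chain map `FC F : FC C ⟶ FC D`. -/
def FCMap (F : FsetFunctor C D) : C.FC.Hom D.FC where
  f := (AlgebraicTopology.alternatingFaceMapComplex _).map
    (((SimplicialObject.whiskering _ _).obj AddCommGrpCat.free).map (nerveMap F.toFunctor))
  f_mem p n x hx := by
    refine (AddSubgroup.closure_le ((D.chainsFilt p n).comap (AddCommGrpCat.Hom.hom
      (((AlgebraicTopology.alternatingFaceMapComplex _).map
        (((SimplicialObject.whiskering _ _).obj AddCommGrpCat.free).map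
          (nerveMap F.toFunctor))).f n)))).2 ?_ hx
    rintro _ ⟨y, ⟨c, hc, hy⟩, rfl⟩
    refine AddSubgroup.subset_closure
      ⟨(F.toFunctor.mapComposableArrows n).obj y, ⟨c, hc, fun i => F.map_mem _ (hy i)⟩, ?_⟩
    exact (FreeAbelianGroup.map_of_apply _).symm

/-- The homomorphism `E^r_{p, n-p} C → E^r_{p, n-p} D` induced by `F`. -/
def EMap (F : FsetFunctor C D) (r : ℕ) (p : ℤ) (n : ℕ) : C.FC.E r p n →+ D.FC.E r p n :=
  F.FCMap.EMap r p n

end FsetFunctor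

/-! ### Ordinary categories, generalized metric spaces and digraphs as enriched categories -/

/-- An ordinary small category, with all morphisms of degree `0`. -/
def FsetCat.ofCat (A : Type u) [Category.{v} A] : FsetCat.{u, v} where
  Ob := A
  filt _ _ _ := Set.univ
  filt_mono _ _ _ _ _ := le_rfl
  filt_exhaust _ _ _ := ⟨0, trivial⟩
  id_mem _ := trivial
  comp_mem _ _ _ _ _ _ := trivial

/-- A functor between ordinary categories as a functor of enriched categories. -/
def FsetFunctor.ofFunctor {A : Type u} [Category.{v} A] {B : Type u'} [Category.{v'} B]
    (F : A ⥤ B) : FsetFunctor (FsetCat.ofCat A) (FsetCat.ofCat B) where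
  toFunctor := F
  map_mem _ _ _ := trivial

/-- A generalized metric space: the distance need not be symmetric, finite or non-degenerate. -/
structure GMetSpace where
  Pt : Type u
  d : Pt → Pt → ℝ≥0∞
  d_self : ∀ x, d x x = 0
  triangle : ∀ x y z, d x z ≤ d x y + d y z

/-- A `1`-Lipschitz map of generalized metric spaces. -/
structure LipMap (X : GMetSpace.{u}) (Y : GMetSpace.{u'}) where
  toFun : X.Pt → Y.Pt
  lip : ∀ x x', Y.d (toFun x) (toFun x') ≤ X.d x x'

/-- A generalized metric space as an enriched category: there is exactly one morphism `x ⟶ y`, of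
degree `d x y`, if `d x y < ∞`, and none otherwise. -/
def FsetCat.ofGMet (X : GMetSpace.{u}) : FsetCat.{u, 0} where
  Ob := X.Pt
  cat :=
    { Hom := fun x y => PLift (X.d x y ≠ ∞)
      id := fun x => ⟨by simp [X.d_self x]⟩
      comp := fun {x y z} f g =>
        ⟨ne_top_of_le_ne_top (ENNReal.add_ne_top.2 ⟨f.down, g.down⟩) (X.triangle x y z)⟩ }
  filt x y ℓ := {_f | X.d x y ≤ ℓ}
  filt_mono x y ℓ ℓ' h _ (hf : X.d x y ≤ ℓ) := hf.trans (ENNReal.coe_le_coe.2 h)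
  filt_exhaust x y f := ⟨(X.d x y).toNNReal, (ENNReal.coe_toNNReal f.down).ge⟩
  id_mem x := by simp [X.d_self x]
  comp_mem {x y z} f g ℓ ℓ' hf hg := by
    refine (X.triangle x y z).trans ?_
    rw [ENNReal.coe_add]
    exact add_le_add hf hg

/-- A `1`-Lipschitz map as a functor of enriched categories. -/
def FsetFunctor.ofLip {X : GMetSpace.{u}} {Y : GMetSpace.{u'}} (f : LipMap X Y) :
    FsetFunctor (FsetCat.ofGMet X) (FsetCat.ofGMet Y) where
  toFunctor :=
    { obj := f.toFun
      map := fun {x y} h => ⟨ne_top_of_le_ne_top h.down (f.lip x y)⟩ }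
  map_mem {x y} _ _ h := (f.lip x y).trans h

/-- There is a directed path `a = s 0 → s 1 → ⋯ → s n = b` with `n` edges. -/
def Digraph.StepsTo {V : Type u} (G : Digraph V) (n : ℕ) (a b : V) : Prop :=
  ∃ s : ℕ → V, s 0 = a ∧ s n = b ∧ ∀ i < n, G.Adj (s i) (s (i + 1))

theorem Digraph.StepsTo.trans {V : Type u} {G : Digraph V} {m n : ℕ} {a b c : V}
    (h : G.StepsTo m a b) (h' : G.StepsTo n b c) : G.StepsTo (m + n) a c := by
  obtain ⟨s, rfl, rfl, hs⟩ := h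
  obtain ⟨t, ht, rfl, ht'⟩ := h'
  refine ⟨fun i => if i ≤ m then s i else t (i - m), by simp, ?_, fun i hi => ?_⟩
  · by_cases hn : n = 0
    · subst hn; simp [ht]
    · simp [hn]
  · rcases lt_trichotomy i m with him | rfl | him
    · simpa [him.le, Nat.succ_le_of_lt him] using hs i him
    · simpa [ht] using ht' 0 (by lia)
    · have h1 : ¬ i ≤ m := by lia
      have h2 : ¬ i + 1 ≤ m := by lia
      have h3 : i + 1 - m = i - m + 1 := by lia
      simpa [h1, h2, h3] using ht' (i - m) (by lia)

/-- The directed path metric: the minimal number of edges of a directed path, and `∞` if there is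
none. -/
def Digraph.pathSpace {V : Type u} (G : Digraph V) : GMetSpace.{u} where
  Pt := V
  d a b := ⨅ (n : ℕ) (_ : G.StepsTo n a b), (n : ℝ≥0∞)
  d_self a := le_antisymm (iInf₂_le_of_le 0 ⟨fun _ => a, rfl, rfl, by simp⟩ (by simp)) zero_le
  triangle a b c := by
    simp only [ENNReal.iInf_add, ENNReal.add_iInf]
    refine le_iInf fun n => le_iInf fun hn => le_iInf fun m => le_iInf fun hm => ?_
    exact iInf₂_le_of_le (m + n) (hm.trans hn) (by push_cast; exact le_rfl)

/-- A homomorphism of digraphs: a map that does not increase the directed path metric, equivalently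
a map that sends every edge to an edge or to a single vertex. -/
abbrev DigraphHom {V : Type u} {W : Type u'} (G : Digraph V) (H : Digraph W) :=
  LipMap G.pathSpace H.pathSpace

/-- The Cartesian product of a digraph with the digraph `0 → 1`. -/
def Digraph.cylinder {V : Type u} (G : Digraph V) : Digraph (V × Fin 2) where
  Adj x y := (x.1 = y.1 ∧ x.2 = 0 ∧ y.2 = 1) ∨ (G.Adj x.1 y.1 ∧ x.2 = y.2)

/-- A one-step homotopy from `f` to `g`: a digraph homomorphism from the cylinder that restricts to
`f` and `g` at the two ends. -/
def OneStepHomotopy {V : Type u} {W : Type u'} {G : Digraph V} {H : Digraph W}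
    (f g : DigraphHom G H) : Prop :=
  ∃ h : DigraphHom G.cylinder H, ∀ x : V, h.toFun (x, 0) = f.toFun x ∧ h.toFun (x, 1) = g.toFun x

end

open scoped Simplicial

/-! An `r`-natural transformation `τ` acts like a homotopy of speed `r`. A simplex `x` of the nerve
of `C` yields prisms: `τ` is applied to a degeneracy of `x` paired with a monotone map to `⦋1⦌`.
These form a simplicial homotopy (`simplicialHomotopy`). Along a prism the arrow `0 ⟶ 1` of `I_r` is
crossed at most once, so the level rises by at most `r` (`prism_mem`), and so does the filtration
under the induced chain homotopy `h`.

For `x ∈ Z^{r+1}_p` the two images then differ by `h∂x + ∂hx`, where `h∂x` lies in `F_{p-1}` and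
`∂hx` in `∂F_{p+r}`. Both are divided out on page `r + 1` (`EMap_eq_of_homotopy`).

The special cases ask when `τ` exists. For ordinary categories the levels impose nothing. For metric
spaces hom-sets have at most one element, so only inequalities between distances remain. For
digraphs, Lipschitz conditions can be tested on edges, which identifies one-step homotopies with
`1`-closeness. -/

/-! ### Filtered chain homotopies -/

namespace FilteredComplex

variable {A B : FilteredComplex.{w}}

/-- Filtered chain maps that are chain homotopic, by a homotopy that raises the filtration by at
most `r`, agree on the page `r + 1`. -/
theorem Hom.EMap_eq_of_homotopy (φ ψ : Hom A B) (r : ℕ) (H : Homotopy φ.f ψ.f)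
    (hH : ∀ (p : ℤ) (n : ℕ) (x : A.K.X n), x ∈ A.F p n → H.hom n (n + 1) x ∈ B.F (p + r) (n + 1))
    (p : ℤ) (n : ℕ) : φ.EMap (r + 1) p n = ψ.EMap (r + 1) p n := by
  refine QuotientAddGroup.addMonoidHom_ext _ (AddMonoidHom.ext fun x => ?_)
  obtain ⟨x, hx⟩ := x
  refine (QuotientAddGroup.eq_iff_sub_mem
    (N := (B.B' (r + 1) p n).addSubgroupOf (B.Z (r + 1) p n))).2 ?_
  change φ.f.f n x - ψ.f.f n x ∈ B.B' (r + 1) p n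
  obtain ⟨y, hy, hcomm⟩ : ∃ y ∈ B.F (p - 1) n,
      φ.f.f n x - ψ.f.f n x = y + B.K.d (n + 1) n (H.hom n (n + 1) x) := by
    have hc := ConcreteCategory.congr_hom (H.comm n) x
    rw [prevD_eq (j' := n + 1) (w := by simp)] at hc
    cases n with
    | zero =>
      -- No differential leaves degree `0`, so the term `h∂x` is absent.
      refine ⟨0, zero_mem _, ?_⟩
      rw [dNext_eq_zero _ _ (by simp), zero_add] at hc
      rw [hc]
      exact (add_sub_cancel_right (_ : B.K.X _) _).trans (zero_add _).symm
    | succ n =>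
      rw [dNext_eq (i' := n) (w := by simp)] at hc
      refine ⟨H.hom n (n + 1) (A.K.d (n + 1) n x), ?_, ?_⟩
      · have := hH _ _ _ (hx.2 n)
        -- This is why the page is `r + 1`: `∂` lowers the filtration of `x` by `r + 1` and `h`
        -- gives back at most `r`.
        have e : p - ((r + 1 : ℕ) : ℤ) + r = p - 1 := by push_cast; ring
        rwa [e] at this
      · rw [hc]
        exact add_sub_cancel_right _ _
  have hZ : φ.f.f n x - ψ.f.f n x ∈ B.Z (r + 1) p n :=
    sub_mem (φ.map_Z _ _ _ _ hx) (ψ.map_Z _ _ _ _ hx)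
  have hdd : ∀ m, B.K.d n m (B.K.d (n + 1) n (H.hom n (n + 1) x)) = 0 := fun m => by
    rw [← ConcreteCategory.comp_apply, B.K.d_comp_d]
    rfl
  have hyp : y ∈ B.F p n := B.mono n (by lia) hy
  rw [hcomm] at hZ ⊢
  -- The summand `y` is a relative cycle because it has the same boundary as the whole difference;
  -- `∂hx` lies in `F_p` because the difference and `y` do.
  refine AddSubgroup.add_mem_sup ⟨⟨hyp, fun m => ?_⟩, hy⟩ ⟨⟨_, ?_, rfl⟩, ?_⟩
  · have := hZ.2 m
    rwa [map_add, hdd, add_zero] at this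
  · have := hH _ _ _ hx.1
    have e : p + ((r + 1 : ℕ) : ℤ) - 1 = p + r := by push_cast; ring
    rwa [e]
  · exact (AddSubgroup.add_mem_cancel_left _ hyp).1 hZ.1

end FilteredComplex

/-! ### The prism operators of an `r`-natural transformation -/

namespace RNatTrans

variable {r : ℝ≥0} {C D : FsetCat.{u, v}} {F G : FsetFunctor C D}

/-- The simplex of the nerve of `D` obtained by applying an `r`-natural transformation to a
simplex `(x ∘ φ, ε)` of the nerve of `C × I_r`. -/
def prism (T : RNatTrans r F G) {m n : ℕ} (φ : ⦋m⦌ ⟶ ⦋n⦌) (ε : ⦋m⦌ ⟶ ⦋1⦌)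
    (x : ComposableArrows C.Ob n) : ComposableArrows D.Ob m :=
  Functor.prod' (C := (FsetCat.interval r).Ob) (φ.toOrderHom.monotone.functor ⋙ x)
    ε.toOrderHom.monotone.functor ⋙ T.τ.toFunctor

theorem prism_const_zero (T : RNatTrans r F G) {n : ℕ} (x : ComposableArrows C.Ob n) :
    T.prism (𝟙 _) (SimplexCategory.const _ _ 0) x = (F.toFunctor.mapComposableArrows n).obj x := by
  rw [← T.at_zero]
  rfl

theorem prism_const_one (T : RNatTrans r F G) {n : ℕ} (x : ComposableArrows C.Ob n) :
    T.prism (𝟙 _) (SimplexCategory.const _ _ 1) x = (G.toFunctor.mapComposableArrows n).obj x := by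
  rw [← T.at_one]
  rfl

/-- Levels add in the product. The first component arises from `x` by a simplicial operator, hence
stays in level `ℓ`; the second is the image under an operator of a simplex of level `r`. -/
theorem prism_mem (T : RNatTrans r F G) {m n : ℕ} (φ : ⦋m⦌ ⟶ ⦋n⦌) (ε : ⦋m⦌ ⟶ ⦋1⦌) {ℓ : ℝ}
    {x : ComposableArrows C.Ob n} (hx : x ∈ C.nerveLevel n ℓ) :
    T.prism φ ε x ∈ D.nerveLevel m (ℓ + r) := by
  -- The edge `0 ⟶ 1` of `I_r`; every `ε` is a pullback of it.
  let y : ComposableArrows (FsetCat.interval r).Ob 1 := 𝟭 (Fin 2)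
  have hy : y ∈ (FsetCat.interval r).nerveLevel 1 r :=
    ⟨fun _ => r, by simp, fun _ _ => le_rfl⟩
  obtain ⟨c, hc, hcx⟩ := C.nerve_map_mem φ ℓ x hx
  obtain ⟨c', hc', hcy⟩ := (FsetCat.interval r).nerve_map_mem ε r y hy
  refine ⟨c + c', ?_, fun i => T.τ.map_mem _ ⟨c i, c' i, rfl, hcx i, hcy i⟩⟩
  simp only [Pi.add_apply, Finset.sum_add_distrib, NNReal.coe_add]
  exact add_le_add hc hc'

end RNatTrans

/-! ### Monotone maps to `⦋1⦌` -/

/-- The map `⦋n⦌ ⟶ ⦋1⦌` that takes the value `0` exactly at the indices `≤ i`. -/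
def SimplexCategory.step {n : ℕ} (i : Fin (n + 1)) : ⦋n⦌ ⟶ ⦋1⦌ :=
  SimplexCategory.Hom.mk
    { toFun := fun j => if j ≤ i then 0 else 1
      monotone' := fun j k h => by
        by_cases hk : k ≤ i
        · simp [hk, h.trans hk]
        · simp only [hk, if_false]
          exact Fin.le_last _ }

/-- A map to `⦋1⦌` is determined by where it is `0`, so identities between such maps become
comparisons of indices. -/
theorem SimplexCategory.comp_step_eq {l m n : ℕ} {φ : ⦋l⦌ ⟶ ⦋m⦌} {ψ : ⦋l⦌ ⟶ ⦋n⦌} {i : Fin (m + 1)}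
    {j : Fin (n + 1)} (h : ∀ k, φ.toOrderHom k ≤ i ↔ ψ.toOrderHom k ≤ j) :
    φ ≫ step i = ψ ≫ step j := by
  ext k : 3
  exact if_congr (h k) rfl rfl

theorem SimplexCategory.comp_step_eq_step {l m : ℕ} {φ : ⦋l⦌ ⟶ ⦋m⦌} {i : Fin (m + 1)}
    {j : Fin (l + 1)} (h : ∀ k, φ.toOrderHom k ≤ i ↔ k ≤ j) : φ ≫ step i = step j :=
  comp_step_eq (ψ := 𝟙 _) h

/-! ### The simplicial homotopy and invariance of the page `r + 1` -/

namespace RNatTrans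

variable {r : ℝ≥0} {C D : FsetCat.{u, v}} {F G : FsetFunctor C D}

theorem prism_congr (T : RNatTrans r F G) {m n : ℕ} {φ φ' : ⦋m⦌ ⟶ ⦋n⦌} {ε ε' : ⦋m⦌ ⟶ ⦋1⦌}
    (x : ComposableArrows C.Ob n) (h : φ = φ') (h' : ε = ε') :
    T.prism φ ε x = T.prism φ' ε' x := by
  rw [h, h']

open SimplexCategory in
/-- The simplicial homotopy between the maps of nerves given by an `r`-natural transformation. -/
def simplicialHomotopy (T : RNatTrans r F G) :
    SimplicialObject.Homotopy (nerveMap F.toFunctor) (nerveMap G.toFunctor) where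
  -- The `i`-th prism repeats vertex `i` of `x` and passes from `F` to `G` between the two copies.
  -- Each axiom below splits into a simplicial identity in the first coordinate and a comparison of
  -- zero sets in the second.
  h i := ↾fun x => T.prism (σ i) (step i.castSucc) x
  h_zero_comp_δ_zero n := by
    ext x
    change T.prism (δ 0 ≫ σ 0) (δ 0 ≫ step (Fin.castSucc 0)) x = _
    refine (T.prism_congr x ?_ ?_).trans (T.prism_const_one x)
    · exact δ_comp_σ_self (i := 0)
    · ext j : 3
      exact if_neg (t := (0 : Fin 2)) (not_le.2 (Fin.succ_pos j))
  h_last_comp_δ_last n := by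
    ext x
    change T.prism (δ (Fin.last (n + 1)) ≫ σ (Fin.last n))
      (δ (Fin.last (n + 1)) ≫ step (Fin.last n).castSucc) x = _
    refine (T.prism_congr x ?_ ?_).trans (T.prism_const_zero x)
    · exact δ_comp_σ_succ (i := Fin.last n)
    · ext j : 3
      exact if_pos (by simpa [δ] using! j.le_last)
  h_succ_comp_δ_castSucc_of_lt {n} i j hij := by
    ext x
    change T.prism (δ i.castSucc ≫ σ j.succ) (δ i.castSucc ≫ step j.succ.castSucc) x =
      T.prism (σ j ≫ δ i) (step j.castSucc) x
    refine T.prism_congr x (δ_comp_σ_of_le hij) ?_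
    refine comp_step_eq_step fun k => ?_
    change Fin.succAbove _ k ≤ _ ↔ _
    simp only [Fin.succAbove]
    grind
  h_succ_comp_δ_castSucc_succ {n} j := by
    ext x
    change T.prism (δ j.castSucc.succ ≫ σ j.succ) (δ j.castSucc.succ ≫ step j.succ.castSucc) x =
      T.prism (δ j.castSucc.succ ≫ σ j.castSucc) (δ j.castSucc.succ ≫ step j.castSucc.castSucc) x
    refine T.prism_congr x ?_ ?_
    · exact (δ_comp_σ_self (i := j.succ)).trans (δ_comp_σ_succ (i := j.castSucc)).symm
    -- The two step maps differ only at the index `j + 1`, which this face omits: adjacent prisms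
    -- share the face.
    · refine comp_step_eq fun k => ?_
      change Fin.succAbove _ k ≤ _ ↔ Fin.succAbove _ k ≤ _
      simp only [Fin.succAbove]
      grind
  h_castSucc_comp_δ_succ_of_lt {n} i j hij := by
    ext x
    change T.prism (δ i.succ ≫ σ j.castSucc) (δ i.succ ≫ step j.castSucc.castSucc) x =
      T.prism (σ j ≫ δ i) (step j.castSucc) x
    refine T.prism_congr x (δ_comp_σ_of_gt hij) ?_
    refine comp_step_eq_step fun k => ?_
    change Fin.succAbove _ k ≤ _ ↔ _
    simp only [Fin.succAbove]
    grind
  h_comp_σ_castSucc_of_le {n} i j hij := by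
    ext x
    change T.prism (σ i.castSucc ≫ σ j) (σ i.castSucc ≫ step j.castSucc) x =
      T.prism (σ j.succ ≫ σ i) (step j.succ.castSucc) x
    refine T.prism_congr x (σ_comp_σ hij) ?_
    refine comp_step_eq_step fun k => ?_
    change Fin.predAbove _ k ≤ _ ↔ _
    simp only [Fin.predAbove]
    grind [Fin.coe_castPred]
  h_comp_σ_succ_of_lt {n} i j hij := by
    ext x
    change T.prism (σ i.succ ≫ σ j) (σ i.succ ≫ step j.castSucc) x =
      T.prism (σ j.castSucc ≫ σ i) (step j.castSucc.castSucc) x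
    refine T.prism_congr x (σ_comp_σ hij).symm ?_
    refine comp_step_eq_step fun k => ?_
    change Fin.predAbove _ k ≤ _ ↔ _
    simp only [Fin.predAbove]
    grind [Fin.coe_castPred]

theorem EMap_eq (r : ℕ) (T : RNatTrans r F G) (p : ℤ) (n : ℕ) :
    F.EMap (r + 1) p n = G.EMap (r + 1) p n := by
  let H := T.simplicialHomotopy.whiskerRight AddCommGrpCat.free
  refine FilteredComplex.Hom.EMap_eq_of_homotopy F.FCMap G.FCMap r H.toChainHomotopy ?_ p n
  intro p n x hx
  refine (AddSubgroup.closure_le ((D.chainsFilt (p + r) (n + 1)).comap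
    (H.toChainHomotopy.hom n (n + 1)).hom)).2 ?_ hx
  rintro _ ⟨y, hy, rfl⟩
  change (H.toChainHomotopy.hom n (n + 1)).hom (FreeAbelianGroup.of y) ∈
    D.chainsFilt (p + r) (n + 1)
  have e : H.toChainHomotopy.hom n (n + 1) = _ :=
    SimplicialObject.Homotopy.ToChainHomotopy.hom_eq H n
  rw [e]
  -- The chain homotopy is minus a signed sum of prisms, so it suffices to bound the level of each
  -- prism.
  refine neg_mem (AddCommGrpCat.sum_zsmul_apply_mem _ _ _ _ fun i => AddSubgroup.subset_closure
    ⟨T.prism (SimplexCategory.σ i) (SimplexCategory.step i.castSucc) y, ?_, ?_⟩)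
  · have := T.prism_mem (SimplexCategory.σ i) (SimplexCategory.step i.castSucc) hy
    push_cast at this ⊢
    exact this
  · exact (FreeAbelianGroup.map_of_apply _).symm

end RNatTrans

/-! ### Functoriality of the pages -/

namespace FsetFunctor

variable {C D E : FsetCat.{u, v}}

/-- The identity functor. -/
def id (C : FsetCat.{u, v}) : FsetFunctor C C where
  toFunctor := 𝟭 _
  map_mem _ _ h := h

/-- The composition of functors of categories enriched over filtered sets. -/
def comp (F : FsetFunctor C D) (G : FsetFunctor D E) : FsetFunctor C E where
  toFunctor := F.toFunctor ⋙ G.toFunctor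
  map_mem _ _ h := G.map_mem _ (F.map_mem _ h)

theorem FCMap_id_f : (FsetFunctor.id C).FCMap.f = 𝟙 _ := by
  have h : nerveMap (FsetFunctor.id C).toFunctor = 𝟙 (nerve C.Ob) := rfl
  dsimp only [FCMap]
  rw [h, CategoryTheory.Functor.map_id]
  exact CategoryTheory.Functor.map_id _ _

theorem FCMap_comp_f (F : FsetFunctor C D) (G : FsetFunctor D E) :
    (F.comp G).FCMap.f = F.FCMap.f ≫ G.FCMap.f := by
  have h : nerveMap (F.comp G).toFunctor = nerveMap F.toFunctor ≫ nerveMap G.toFunctor := rfl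
  dsimp only [FCMap]
  rw [h, Functor.map_comp, Functor.map_comp]
  rfl

theorem EMap_id (r : ℕ) (p : ℤ) (n : ℕ) :
    (FsetFunctor.id C).EMap r p n = AddMonoidHom.id _ := by
  refine QuotientAddGroup.addMonoidHom_ext _ (AddMonoidHom.ext fun x => ?_)
  refine congrArg (QuotientAddGroup.mk (s := (C.FC.B' r p n).addSubgroupOf (C.FC.Z r p n)))
    (Subtype.ext ?_)
  change (FsetFunctor.id C).FCMap.f.f n x.1 = x.1
  rw [FCMap_id_f]
  rfl

theorem EMap_comp (F : FsetFunctor C D) (G : FsetFunctor D E) (r : ℕ) (p : ℤ) (n : ℕ) :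
    (F.comp G).EMap r p n = (G.EMap r p n).comp (F.EMap r p n) := by
  refine QuotientAddGroup.addMonoidHom_ext _ (AddMonoidHom.ext fun x => ?_)
  refine congrArg (QuotientAddGroup.mk (s := (E.FC.B' r p n).addSubgroupOf (E.FC.Z r p n)))
    (Subtype.ext ?_)
  change (F.comp G).FCMap.f.f n x.1 = G.FCMap.f.f n (F.FCMap.f.f n x.1)
  rw [FCMap_comp_f]
  rfl

end FsetFunctor

/-! ### Ordinary categories -/

/-- The natural transformation `(-, 0) ⟶ (-, 1)` of functors `C ⥤ C × I_r`. -/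
def FsetCat.inclHom (C : FsetCat.{u, v}) (r : ℝ≥0) : C.incl r 0 ⟶ C.incl r 1 where
  app a := Prod.mkHom (𝟙 a) (homOfLE (Fin.zero_le 1) : (0 : Fin 2) ⟶ 1)
  naturality _ _ f := Prod.ext ((Category.comp_id f).trans (Category.id_comp f).symm)
    (Subsingleton.elim (α := ((0 : Fin 2) ⟶ 1)) _ _)

section OrdinaryCategories

variable {A : Type u} [Category.{v} A] {B : Type u'} [Category.{v'} B]

/-- `mk₁ α` is a functor from `Fin 2` to `A ⥤ B`; flipping and uncurrying turns it into a functor on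
`A × Fin 2`. Its restriction to an end is strictly the given functor, as `RNatTrans` demands, since
the extra factor is an identity. -/
theorem sectL_zero_comp_uncurry_flip_mk₁ {F G : A ⥤ B} (α : F ⟶ G) :
    Prod.sectL A (0 : Fin 2) ⋙ Functor.uncurry.obj (Functor.flip (ComposableArrows.mk₁ α)) = F :=
  CategoryTheory.Functor.hext (fun _ => rfl) fun _ _ f => heq_of_eq (Category.comp_id (F.map f))

theorem sectL_one_comp_uncurry_flip_mk₁ {F G : A ⥤ B} (α : F ⟶ G) :
    Prod.sectL A (1 : Fin 2) ⋙ Functor.uncurry.obj (Functor.flip (ComposableArrows.mk₁ α)) = G :=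
  CategoryTheory.Functor.hext (fun _ => rfl) fun _ _ f => heq_of_eq (Category.comp_id (G.map f))

/-- A natural transformation of functors of ordinary categories as an `r`-natural
transformation. -/
def RNatTrans.ofNatTrans (r : ℝ≥0) {F G : A ⥤ B} (α : F ⟶ G) :
    RNatTrans r (FsetFunctor.ofFunctor F) (FsetFunctor.ofFunctor G) where
  τ :=
    { toFunctor := Functor.uncurry.obj (Functor.flip (ComposableArrows.mk₁ α))
      map_mem _ _ _ := trivial }
  at_zero := sectL_zero_comp_uncurry_flip_mk₁ α
  at_one := sectL_one_comp_uncurry_flip_mk₁ α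

theorem RNatTrans.nonempty_ofFunctor_iff (r : ℝ≥0) (F G : A ⥤ B) :
    Nonempty (RNatTrans r (FsetFunctor.ofFunctor F) (FsetFunctor.ofFunctor G)) ↔
      Nonempty (F ⟶ G) := by
  refine ⟨fun ⟨T⟩ => ⟨?_⟩, fun ⟨α⟩ => ⟨.ofNatTrans r α⟩⟩
  -- The components are the images under `τ` of the arrows `(𝟙 a, 0 ⟶ 1)`; `eqToHom` accounts for
  -- the prescribed ends being equalities of functors.
  exact eqToHom T.at_zero.symm ≫ Functor.whiskerRight ((FsetCat.ofCat A).inclHom r) T.τ.toFunctor ≫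
    eqToHom T.at_one

end OrdinaryCategories

/-- Unit and counit are `0`-natural transformations, so by invariance and functoriality the inverse
equivalence induces a two-sided inverse on page `1`. -/
theorem FsetFunctor.EMap_bijective_of_equivalence {A B : Type u} [Category.{v} A] [Category.{v} B]
    (e : A ≌ B) (p : ℤ) (n : ℕ) :
    Function.Bijective ((FsetFunctor.ofFunctor e.functor).EMap 1 p n) := by
  let F := FsetFunctor.ofFunctor e.functor
  let G := FsetFunctor.ofFunctor e.inverse
  have hunit : (FsetFunctor.id (FsetCat.ofCat A)).EMap 1 p n = (F.comp G).EMap 1 p n :=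
    RNatTrans.EMap_eq 0 (RNatTrans.ofNatTrans _ e.unit) p n
  have hcounit : (G.comp F).EMap 1 p n = (FsetFunctor.id (FsetCat.ofCat B)).EMap 1 p n :=
    RNatTrans.EMap_eq 0 (RNatTrans.ofNatTrans _ e.counit) p n
  rw [EMap_id, EMap_comp] at hunit hcounit
  exact Function.bijective_iff_has_inverse.2 ⟨G.EMap 1 p n,
    fun x => (DFunLike.congr_fun hunit x).symm, fun x => DFunLike.congr_fun hcounit x⟩

/-! ### Generalized metric spaces -/

theorem RNatTrans.nonempty_ofLip_iff {X : GMetSpace.{u}} {Y : GMetSpace.{u'}} (f g : LipMap X Y)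
    (r : ℝ≥0) : Nonempty (RNatTrans r (FsetFunctor.ofLip f) (FsetFunctor.ofLip g)) ↔
      ∀ x, Y.d (f.toFun x) (g.toFun x) ≤ r := by
  have hsub : ∀ a b : (FsetCat.ofGMet Y).Ob, Subsingleton (a ⟶ b) := fun a b =>
    inferInstanceAs (Subsingleton (PLift _))
  constructor
  · rintro ⟨T⟩ x
    have h0 : T.τ.toFunctor.obj (x, (0 : Fin 2)) = f.toFun x :=
      Functor.congr_obj T.at_zero x
    have h1 : T.τ.toFunctor.obj (x, (1 : Fin 2)) = g.toFun x :=
      Functor.congr_obj T.at_one x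
    -- The arrow `(𝟙 x, 0 ⟶ 1)` has level `0 + r`; its image runs from `f x` to `g x`.
    have h := T.τ.map_mem (((FsetCat.ofGMet X).inclHom r).app x) (ℓ := r)
      ⟨0, r, zero_add r, (FsetCat.ofGMet X).id_mem x, fun _ => le_rfl⟩
    change Y.d (T.τ.toFunctor.obj (x, (0 : Fin 2))) (T.τ.toFunctor.obj (x, (1 : Fin 2))) ≤ r at h
    rwa [h0, h1] at h
  · intro h
    let F : Fin 2 → X.Pt → Y.Pt := ![f.toFun, g.toFun]
    have key : ∀ (i j : Fin 2) (x y : X.Pt) (ℓ ℓ' : ℝ≥0), i ≤ j → X.d x y ≤ ℓ →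
        (i ≠ j → r ≤ ℓ') → Y.d (F i x) (F j y) ≤ (ℓ + ℓ' : ℝ≥0) := by
      intro i j x y ℓ ℓ' hij hxy hr
      rw [ENNReal.coe_add]
      match i, j with
      | 0, 0 => exact ((f.lip x y).trans hxy).trans le_self_add
      | 1, 1 => exact ((g.lip x y).trans hxy).trans le_self_add
      | 0, 1 =>
        -- The diagonal case goes through `f y`: first along `f`, then across at cost at most `r`.
        refine (Y.triangle _ (f.toFun y) _).trans (add_le_add ((f.lip x y).trans hxy) ?_)
        exact (h y).trans (ENNReal.coe_le_coe.2 (hr (by decide)))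
      | 1, 0 => exact absurd hij (by decide)
    refine ⟨⟨{ toFunctor := { obj := fun a => F a.2 a.1, map := fun {a b} φ => ⟨?_⟩ },
               map_mem := ?_ }, ?_, ?_⟩⟩
    · obtain ⟨ℓ, hℓ⟩ := (FsetCat.ofGMet X).filt_exhaust _ _ φ.1
      exact ne_top_of_le_ne_top ENNReal.coe_ne_top
        (key a.2 b.2 a.1 b.1 ℓ r (leOfHom (X := Fin 2) φ.2) hℓ fun _ => le_rfl)
    · rintro a b φ _ ⟨ℓ, ℓ', rfl, hℓ, hℓ'⟩
      exact key a.2 b.2 a.1 b.1 ℓ ℓ' (leOfHom (X := Fin 2) φ.2) hℓ hℓ'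
    · exact CategoryTheory.Functor.ext (fun _ => rfl) fun _ _ _ => Subsingleton.elim _ _
    · exact CategoryTheory.Functor.ext (fun _ => rfl) fun _ _ _ => Subsingleton.elim _ _

/-! ### Digraphs -/

namespace Digraph

variable {V : Type u} {G : Digraph V}

theorem Adj.pathSpace_d_le_one {a b : V} (h : G.Adj a b) : G.pathSpace.d a b ≤ 1 := by
  refine iInf₂_le_of_le 1 ⟨fun i => if i = 0 then a else b, by simp, by simp, ?_⟩ (by simp)
  intro i hi
  obtain rfl : i = 0 := by lia
  simpa using h

/-- A map of the vertices is `1`-Lipschitz if it is so on the edges. -/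
theorem d_le_pathSpace_d (Y : GMetSpace.{u'}) (F : V → Y.Pt)
    (hF : ∀ a b, G.Adj a b → Y.d (F a) (F b) ≤ 1) (a b : V) :
    Y.d (F a) (F b) ≤ G.pathSpace.d a b := by
  refine le_iInf₂ fun n ⟨s, h0, hn, hs⟩ => ?_
  subst h0 hn
  clear * - hF hs
  induction n with
  | zero => rw [Y.d_self]; exact zero_le
  | succ n ih =>
    refine (Y.triangle _ (F (s n)) _).trans ?_
    push_cast
    exact add_le_add (ih fun i hi => hs i (by lia)) (hF _ _ (hs n (by lia)))

end Digraph

/-- The cylinder has two kinds of edges: those `(x, 0) → (x, 1)` encode `1`-closeness, and those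
inside an end are controlled by `f` or `g` being Lipschitz. Edges suffice by
`Digraph.d_le_pathSpace_d`. -/
theorem oneStepHomotopy_iff {V : Type u} {W : Type u'} {G : Digraph V} {H : Digraph W}
    (f g : DigraphHom G H) :
    OneStepHomotopy f g ↔ ∀ x, H.pathSpace.d (f.toFun x) (g.toFun x) ≤ 1 := by
  constructor
  · rintro ⟨h, hfg⟩ x
    have hadj : G.cylinder.Adj (x, 0) (x, 1) := Or.inl ⟨rfl, rfl, rfl⟩
    have := (h.lip (x, 0) (x, 1)).trans hadj.pathSpace_d_le_one
    rwa [(hfg x).1, (hfg x).2] at this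
  · intro h
    let F : Fin 2 → V → W := ![f.toFun, g.toFun]
    refine ⟨⟨fun a => F a.2 a.1, Digraph.d_le_pathSpace_d _ _ ?_⟩, fun x => ⟨rfl, rfl⟩⟩
    rintro ⟨a, i⟩ ⟨b, j⟩ (⟨hab, hi, hj⟩ | ⟨hab, hij⟩)
    · obtain rfl : a = b := hab
      obtain rfl : i = 0 := hi
      obtain rfl : j = 1 := hj
      exact h a
    · obtain rfl : i = j := hij
      match i with
      | 0 => exact (f.lip a b).trans hab.pathSpace_d_le_one
      | 1 => exact (g.lip a b).trans hab.pathSpace_d_le_one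

theorem mainTheorem2 :
    -- invariance of the `(r+1)`-th page under `r`-natural transformations
    (∀ (C D : FsetCat.{u, v}), C.IsIntegral → D.IsIntegral → ∀ (r : ℕ) (F G : FsetFunctor C D),
      Nonempty (RNatTrans r F G) →
        ∀ (p : ℤ) (n : ℕ), F.EMap (r + 1) p n = G.EMap (r + 1) p n) ∧
    -- ordinary categories, `r = 0`
    ((∀ (A B : Type u) [Category.{v} A] [Category.{v} B] (F G : A ⥤ B),
        Nonempty (RNatTrans 0 (.ofFunctor F) (.ofFunctor G)) ↔ Nonempty (F ⟶ G)) ∧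
      (∀ (A B : Type u) [Category.{v} A] [Category.{v} B] (e : A ≌ B) (p : ℤ) (n : ℕ),
        Function.Bijective ((FsetFunctor.ofFunctor e.functor).EMap 1 p n))) ∧
    -- digraphs, `r = 1`
    (∀ (V W : Type u) (G : Digraph V) (H : Digraph W) (f g : DigraphHom G H),
      (Nonempty (RNatTrans 1 (.ofLip f) (.ofLip g)) ↔ OneStepHomotopy f g) ∧
      (OneStepHomotopy f g ∨ OneStepHomotopy g f → ∀ (p : ℤ) (n : ℕ),
        (FsetFunctor.ofLip f).EMap 2 p n = (FsetFunctor.ofLip g).EMap 2 p n)) ∧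
    -- generalized metric spaces
    (∀ (X Y : GMetSpace.{u}) (f g : LipMap X Y),
      (∀ r : ℝ≥0, Nonempty (RNatTrans r (.ofLip f) (.ofLip g)) ↔
        ∀ x, Y.d (f.toFun x) (g.toFun x) ≤ r) ∧
      ((∀ x x', X.d x x' = ∞ ∨ ∃ k : ℕ, X.d x x' = k) →
        (∀ y y', Y.d y y' = ∞ ∨ ∃ k : ℕ, Y.d y y' = k) →
        ∀ r : ℕ, (∀ x, Y.d (f.toFun x) (g.toFun x) ≤ r) → ∀ (p : ℤ) (n : ℕ),
          (FsetFunctor.ofLip f).EMap (r + 1) p n = (FsetFunctor.ofLip g).EMap (r + 1) p n)) := by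
  refine ⟨fun C D _ _ r F G ⟨T⟩ p n => T.EMap_eq r p n,
    ⟨fun A B _ _ F G => RNatTrans.nonempty_ofFunctor_iff 0 F G,
      fun A B _ _ e p n => FsetFunctor.EMap_bijective_of_equivalence e p n⟩,
    fun V W G H f g => ?_,
    fun X Y f g => ⟨fun r => RNatTrans.nonempty_ofLip_iff f g r, fun _ _ r h p n => ?_⟩⟩
  · have key : ∀ f g : DigraphHom G H,
        Nonempty (RNatTrans 1 (.ofLip f) (.ofLip g)) ↔ OneStepHomotopy f g := fun f g => by
      rw [RNatTrans.nonempty_ofLip_iff, oneStepHomotopy_iff, ENNReal.coe_one]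
    have heq : ∀ f g : DigraphHom G H, OneStepHomotopy f g → ∀ (p : ℤ) (n : ℕ),
        (FsetFunctor.ofLip f).EMap 2 p n = (FsetFunctor.ofLip g).EMap 2 p n := fun f g h p n => by
      rw [← key, ← Nat.cast_one] at h
      exact h.some.EMap_eq 1 p n
    -- Homotopies are directed, but equality of induced maps is symmetric, so either direction will
    -- do.
    exact ⟨key f g, fun h p n => h.elim (fun h => heq f g h p n) fun h => (heq g f h p n).symm⟩
  · have := (RNatTrans.nonempty_ofLip_iff f g r).2 fun x => by simpa using h x
    exact this.some.EMap_eq r p n
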